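/- For a probability measure $\mu$ with compact support on $\mathbb{R}$ write $G_\mu(z)=\int_{\mathbb R}\frac{\mu(dt)}{z-t}$ for its Stieltjes transform, and let $R_\mu$ be its $R$-transform, i.e. the function analytic near $0$ such that $w\mapsto R_\mu(w)+\frac1w$ is the compositional inverse of $G_\mu$ near infinity: $R_\mu(G_\mu(z))+\frac1{G_\mu(z)}=z$ for $|z|$ large. The free convolution $\mu\boxplus\nu$ is the compactly supported probability measure with $R_{\mu\boxplus\nu}=R_\mu+R_\nu$ near $0$. For $q\in(-1,0)\cup(0,1)$ put \[ R^{\mathrm{quant}(q)}_\mu(z)=R_\mu(z)-\frac{(1-qz)^{-1/q}}{(1-qz)^{-1/q}-1}+\frac1z \] for small $z\ne 0$, and say that a compactly supported probability measure $\rho$ equals $\mu\otimes_q\nu$ if $R^{\mathrm{quant}(q)}_\rho=R^{\mathrm{quant}(q)}_\mu+R^{\mathrm{quant}(q)}_\nu$ near $0$. All powers are principal branches. \textbf{Theorem.} Let $q\in(-1,0)\cup(0,1)$. For every probability measure $\mu$ with compact support on $\mathbb{R}$ there exist a unique compactly supported probability measure $\nu$ on $\mathbb R$ with \[ 1-G_\mu(z)=(1-qG_\nu(z))^{1/q}\quad\text{for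 all } z\in\mathbb{C} \text{ with } |z|^{-1} \text{ small enough,} \] and a unique compactly supported probability measure $\lambda$ on $\mathbb R$ with \[ 1+G_\mu(z-1)=(1-qG_\lambda(z))^{-1/q}\quad\text{for all } z\in\mathbb{C} \text{ with } |z|^{-1} \text{ small enough.} \] The maps $\mathfrak P:\mu\mapsto\nu$ and $\mathfrak Q:\mu\mapsto\lambda$ are injective. Moreover, whenever $\nu_1,\nu_2$ are compactly supported probability measures on $\mathbb R$ with free convolution $\nu_1\boxplus\nu_2$, the measures $\mathfrak P(\nu_1)\otimes_q\mathfrak P(\nu_2)$ and $\mathfrak Q(\nu_1)\otimes_q\mathfrak Q(\nu_2)$ exist, are unique, and \[ \mathfrak P(\nu_1\boxplus\nu_2)=\mathfrak P(\nu_1)\otimes_q\mathfrak P(\nu_2),\qquad \mathfrak Q(\nu_1\boxplus\nu_2)=\mathfrak Q(\nu_1)\otimes_q\mathfrak Q(\nu_2). \] -/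

import Mathlib

open MeasureTheory Filter Topology Bornology

/-- Probability measures on `ℝ` with compact support. -/
abbrev CompactProb : Type :=
  {μ : ProbabilityMeasure ℝ // IsCompact (μ : Measure ℝ).support}

/-- The Stieltjes transform `G_μ(z) = ∫ 1 / (z - t) dμ(t)`. -/
noncomputable def stieltjes (μ : CompactProb) (z : ℂ) : ℂ :=
  ∫ t : ℝ, (z - (t : ℂ))⁻¹ ∂(μ.1 : Measure ℝ)

/-- `R` is (a representative near `0` of) the `R`-transform of `μ`: it is analytic at `0` and
`w ↦ R(w) + 1 / w` is the compositional inverse of `G_μ` at infinity. Since `G_μ` maps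
neighbourhoods of infinity bijectively onto punctured neighbourhoods of `0`, this determines the
germ of `R` at `0`. -/
def IsRTransform (μ : CompactProb) (R : ℂ → ℂ) : Prop :=
  AnalyticAt ℂ R 0 ∧ ∀ᶠ z in cobounded ℂ, R (stieltjes μ z) + (stieltjes μ z)⁻¹ = z

/-- `ρ = μ ⊞ ν`: the `R`-transform of `ρ` is the sum of those of `μ` and `ν`. -/
def IsFreeConvolution (μ ν ρ : CompactProb) : Prop :=
  ∃ Rμ Rν Rρ : ℂ → ℂ, IsRTransform μ Rμ ∧ IsRTransform ν Rν ∧ IsRTransform ρ Rρ ∧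
    ∀ᶠ z in 𝓝 (0 : ℂ), Rρ z = Rμ z + Rν z

/-- The `q`-exponential `e_q(z) = (1 - q z)^(-1/q)` (principal branch, `z` near `0`). -/
noncomputable def qExp (q : ℝ) (z : ℂ) : ℂ :=
  (1 - (q : ℂ) * z) ^ (-1 / (q : ℂ))

/-- `S` is, near `0`, the `q`-deformed quantized `R`-transform
`R_μ(z) - e_q(z) / (e_q(z) - 1) + 1 / z` of `μ`. The singularity at `z = 0` is removable, and the
value of `S` at `0` is left free. -/
def IsQuantizedRTransform (q : ℝ) (μ : CompactProb) (S : ℂ → ℂ) : Prop :=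
  ∃ R : ℂ → ℂ, IsRTransform μ R ∧
    ∀ᶠ z in 𝓝[≠] (0 : ℂ), S z = R z - qExp q z / (qExp q z - 1) + 1 / z

/-- `ρ = μ ⊗_q ν`: the `q`-deformed quantized `R`-transform of `ρ` is the sum of those of
`μ` and `ν`. -/
def IsQuantizedConvolution (q : ℝ) (μ ν ρ : CompactProb) : Prop :=
  ∃ Sμ Sν Sρ : ℂ → ℂ, IsQuantizedRTransform q μ Sμ ∧ IsQuantizedRTransform q ν Sν ∧
    IsQuantizedRTransform q ρ Sρ ∧ ∀ᶠ z in 𝓝[≠] (0 : ℂ), Sρ z = Sμ z + Sν z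

/-- `1 - G_μ(z) = (1 - q G_ν(z))^(1/q)` for all `z` with `|z|` large enough. -/
def PRelation (q : ℝ) (μ ν : CompactProb) : Prop :=
  ∀ᶠ z in cobounded ℂ,
    1 - stieltjes μ z = (1 - (q : ℂ) * stieltjes ν z) ^ (1 / (q : ℂ))

/-- `1 + G_μ(z - 1) = (1 - q G_lam(z))^(-1/q)` for all `z` with `|z|` large enough. -/
def QRelation (q : ℝ) (μ lam : CompactProb) : Prop :=
  ∀ᶠ z in cobounded ℂ,
    1 + stieltjes μ (z - 1) = (1 - (q : ℂ) * stieltjes lam z) ^ (-1 / (q : ℂ))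

/-!
The quantized `R`-transform of `ν` is the `R`-transform of `μ` after the change of variables
`1 / φ + s = e_q / (e_q - 1)`, where `s = 0` for `ν = 𝔓(μ)` and `s = 1` for `ν = 𝔔(μ)`. As this
change of variables does not depend on `μ`, additivity of `R`-transforms becomes additivity of
quantized `R`-transforms. The inverse of `e_q` and the fact that a Stieltjes transform near infinity
determines its measure give uniqueness and injectivity.

Existence: by the binomial series, the Stieltjes transform of the beta law `B(1 - q, 1 + q)` at
`1 / g` is `(1 - (1 - g) ^ q) / q`. Hence the required `G_ν` is `G_κ (1 / G_μ)` with `κ` this beta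
law, that is, `ν` is the monotone convolution of `κ` and `μ`; for `𝔔`, replace `q` by `-q`, reflect
`κ` and shift `μ` by `1`. The monotone convolution is the spectral measure, in the vector state of
the constant function `1`, of the bounded self-adjoint operator `J M_s J* + M_t` on `L²(κ ⊗ μ)`,
where `J` embeds `L²(κ)` as the functions of the first coordinate.
-/

open scoped InnerProductSpace CompactlySupported Nat

/-! ### The Stieltjes transform near infinity -/

lemma map_nhdsNE_of_hasStrictDerivAt {𝕜 : Type*} [NontriviallyNormedField 𝕜] [CompleteSpace 𝕜]
    {f : 𝕜 → 𝕜} {f' x : 𝕜} (h : HasStrictDerivAt f f' x) (hf' : f' ≠ 0) :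
    map f (𝓝[≠] x) = 𝓝[≠] (f x) := by
  refine le_antisymm (h.hasDerivAt.tendsto_nhdsNE hf') fun s hs ↦ ?_
  rw [mem_map, mem_nhdsWithin_iff_eventually] at hs
  rw [mem_nhdsWithin_iff_eventually, ← h.map_nhds_eq hf', eventually_map]
  exact hs.mono fun y hy hne ↦ hy (ne_of_apply_ne f hne)

namespace CompactProb

/-- A probability measure carried by a compact set, as an element of `CompactProb`. -/
noncomputable def ofAE (ρ : Measure ℝ) [IsProbabilityMeasure ρ] {K : Set ℝ} (hK : IsCompact K)
    (h : ∀ᵐ t ∂ρ, t ∈ K) : CompactProb :=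
  ⟨⟨ρ, inferInstance⟩,
    hK.of_isClosed_subset Measure.isClosed_support
      (Measure.support_subset_of_isClosed hK.isClosed h)⟩

/-- The pushforward of a compactly supported probability measure under a continuous map. -/
noncomputable def map (μ : CompactProb) {f : ℝ → ℝ} (hf : Continuous f) : CompactProb :=
  haveI := Measure.isProbabilityMeasure_map (μ := (μ.1 : Measure ℝ)) hf.aemeasurable
  ofAE ((μ.1 : Measure ℝ).map f) (μ.2.image hf) <|
    (ae_map_iff hf.aemeasurable (μ.2.image hf).measurableSet).2 <| by
      filter_upwards [Measure.support_mem_ae (μ := (μ.1 : Measure ℝ))] with t ht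
        using Set.mem_image_of_mem f ht

lemma stieltjes_map (μ : CompactProb) {f : ℝ → ℝ} (hf : Continuous f) (z : ℂ) :
    stieltjes (μ.map hf) z = ∫ t : ℝ, (z - (f t : ℂ))⁻¹ ∂(μ.1 : Measure ℝ) :=
  integral_map hf.aemeasurable (by fun_prop)

lemma stieltjes_map_add_const (μ : CompactProb) (s : ℝ) (z : ℂ) :
    stieltjes (μ.map (continuous_add_const s)) z = stieltjes μ (z - s) := by
  rw [stieltjes_map, stieltjes]
  simp only [Complex.ofReal_add, sub_add_eq_sub_sub, sub_right_comm]

lemma stieltjes_map_neg (μ : CompactProb) (z : ℂ) :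
    stieltjes (μ.map continuous_neg) z = -stieltjes μ (-z) := by
  rw [stieltjes_map, stieltjes, ← integral_neg]
  simp only [Complex.ofReal_neg, ← inv_neg, neg_sub', neg_neg]

lemma exists_ae_abs_le (μ : CompactProb) :
    ∃ M : ℝ, 0 < M ∧ ∀ᵐ t ∂(μ.1 : Measure ℝ), |t| ≤ M := by
  obtain ⟨M, hM, h⟩ := μ.2.isBounded.exists_pos_norm_le
  refine ⟨M, hM, ?_⟩
  filter_upwards [Measure.support_mem_ae (μ := (μ.1 : Measure ℝ))] with t ht using h t ht

/-- The `n`-th moment, as a complex number. -/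
noncomputable def moment (μ : CompactProb) (n : ℕ) : ℂ :=
  ∫ t : ℝ, (t : ℂ) ^ n ∂(μ.1 : Measure ℝ)

lemma hasSum_mul_moment (μ : CompactProb) {M : ℝ} (hM : ∀ᵐ t ∂(μ.1 : Measure ℝ), |t| ≤ M)
    {a : ℕ → ℂ} (ha : Summable fun n ↦ ‖a n‖ * M ^ n) {f : ℝ → ℂ}
    (hf : ∀ t, |t| ≤ M → HasSum (fun n ↦ a n * (t : ℂ) ^ n) (f t)) :
    HasSum (fun n ↦ a n * μ.moment n) (∫ t, f t ∂(μ.1 : Measure ℝ)) := by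
  simp only [moment, ← integral_const_mul]
  refine hasSum_integral_of_dominated_convergence (fun n _ ↦ ‖a n‖ * M ^ n)
    (fun n ↦ by fun_prop) (fun n ↦ ?_) (ae_of_all _ fun _ ↦ ha) (integrable_const _)
    (hM.mono hf)
  filter_upwards [hM] with t ht
  rw [norm_mul, norm_pow, Complex.norm_real, Real.norm_eq_abs]
  gcongr

lemma hasSum_charFun (μ : CompactProb) (s : ℝ) :
    HasSum (fun n ↦ (s * Complex.I) ^ n / (n ! : ℂ) * μ.moment n)
      (charFun (μ.1 : Measure ℝ) s) := by
  obtain ⟨M, -, hM⟩ := μ.exists_ae_abs_le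
  rw [charFun_apply_real]
  refine μ.hasSum_mul_moment hM ?_ fun t _ ↦ ?_
  · convert! Real.summable_pow_div_factorial (|s| * M) using 2 with n
    simp [mul_pow, div_mul_eq_mul_div]
  · convert! NormedSpace.expSeries_div_hasSum_exp (s * t * Complex.I : ℂ) using 2 with n
    · ring
    · rw [Complex.exp_eq_exp_ℂ]

lemma ext_of_moment {μ ν : CompactProb} (h : ∀ n, μ.moment n = ν.moment n) : μ = ν := by
  refine Subtype.ext <| Subtype.ext <|
    Measure.ext_of_charFun (μ := (μ.1 : Measure ℝ)) (ν := (ν.1 : Measure ℝ)) <| funext fun s ↦ ?_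
  refine (μ.hasSum_charFun s).unique ?_
  simpa only [h] using ν.hasSum_charFun s

/-- The moment generating function `∑ mₙ wⁿ` in closed form. -/
noncomputable def momentSeries (μ : CompactProb) (w : ℂ) : ℂ :=
  ∫ t : ℝ, (1 - w * (t : ℂ))⁻¹ ∂(μ.1 : Measure ℝ)

lemma hasFPowerSeriesAt_momentSeries (μ : CompactProb) :
    HasFPowerSeriesAt μ.momentSeries (.ofScalars ℂ μ.moment) 0 := by
  rw [hasFPowerSeriesAt_iff]
  obtain ⟨M, hM₀, hM⟩ := μ.exists_ae_abs_le
  filter_upwards [Metric.ball_mem_nhds (0 : ℂ) (inv_pos.2 hM₀)] with w hw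
  have hwM : ‖w‖ * M < 1 := by rwa [mem_ball_zero_iff, ← one_div, lt_div_iff₀ hM₀] at hw
  simp only [FormalMultilinearSeries.coeff_ofScalars, smul_eq_mul, zero_add]
  refine μ.hasSum_mul_moment hM ?_ fun t ht ↦ ?_
  · simpa only [norm_pow, mul_pow] using summable_geometric_of_lt_one (by positivity) hwM
  · simp only [← mul_pow]
    refine hasSum_geometric_of_norm_lt_one (lt_of_le_of_lt ?_ hwM)
    rw [norm_mul, Complex.norm_real, Real.norm_eq_abs]
    gcongr

/-- The Stieltjes transform in the coordinate `w = 1 / z` at infinity. -/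
noncomputable def stieltjesAtInfty (μ : CompactProb) (w : ℂ) : ℂ := w * μ.momentSeries w

lemma analyticAt_stieltjesAtInfty (μ : CompactProb) : AnalyticAt ℂ μ.stieltjesAtInfty 0 :=
  analyticAt_id.mul μ.hasFPowerSeriesAt_momentSeries.analyticAt

@[simp] lemma stieltjesAtInfty_zero (μ : CompactProb) : μ.stieltjesAtInfty 0 = 0 :=
  zero_mul _

lemma hasStrictDerivAt_stieltjesAtInfty (μ : CompactProb) :
    HasStrictDerivAt μ.stieltjesAtInfty 1 0 := by
  convert! (hasStrictDerivAt_id (0 : ℂ)).mul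
    μ.hasFPowerSeriesAt_momentSeries.analyticAt.hasStrictDerivAt using 1
  simp [momentSeries]

lemma deriv_stieltjesAtInfty_zero (μ : CompactProb) : deriv μ.stieltjesAtInfty 0 = 1 :=
  μ.hasStrictDerivAt_stieltjesAtInfty.hasDerivAt.deriv

lemma stieltjes_eq_stieltjesAtInfty_inv (μ : CompactProb) {z : ℂ} (hz : z ≠ 0) :
    stieltjes μ z = μ.stieltjesAtInfty z⁻¹ := by
  rw [stieltjes, stieltjesAtInfty, momentSeries, ← integral_const_mul]
  congr 1 with t
  rw [← mul_inv, mul_sub, mul_one, mul_inv_cancel_left₀ hz]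

lemma map_stieltjes (μ : CompactProb) : Filter.map (stieltjes μ) (cobounded ℂ) = 𝓝[≠] 0 := by
  calc Filter.map (stieltjes μ) (cobounded ℂ)
      = Filter.map (μ.stieltjesAtInfty ∘ (·⁻¹)) (cobounded ℂ) :=
        Filter.map_congr <| (eventually_ne_cobounded 0).mono fun _ hz ↦
          μ.stieltjes_eq_stieltjesAtInfty_inv hz
    _ = Filter.map μ.stieltjesAtInfty (𝓝[≠] 0) := by
        rw [← Filter.map_map, Filter.map_inv, inv_cobounded₀]
    _ = 𝓝[≠] 0 := by
        simpa using map_nhdsNE_of_hasStrictDerivAt μ.hasStrictDerivAt_stieltjesAtInfty one_ne_zero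

lemma tendsto_stieltjes (μ : CompactProb) :
    Tendsto (stieltjes μ) (cobounded ℂ) (𝓝[≠] 0) := μ.map_stieltjes.le

lemma tendsto_stieltjes_nhds (μ : CompactProb) :
    Tendsto (stieltjes μ) (cobounded ℂ) (𝓝 0) :=
  tendsto_nhds_of_tendsto_nhdsWithin μ.tendsto_stieltjes

lemma eventually_stieltjes_ne_zero (μ : CompactProb) :
    ∀ᶠ z in cobounded ℂ, stieltjes μ z ≠ 0 :=
  μ.tendsto_stieltjes.eventually self_mem_nhdsWithin

lemma eventually_nhdsNE_iff (μ : CompactProb) {p : ℂ → Prop} :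
    (∀ᶠ w in 𝓝[≠] 0, p w) ↔ ∀ᶠ z in cobounded ℂ, p (stieltjes μ z) := by
  rw [← μ.map_stieltjes, eventually_map]

lemma ext_of_stieltjes {μ ν : CompactProb}
    (h : ∀ᶠ z in cobounded ℂ, stieltjes μ z = stieltjes ν z) : μ = ν := by
  have h_ne : ∀ᶠ w in 𝓝[≠] (0 : ℂ), μ.momentSeries w = ν.momentSeries w := by
    rw [← inv_cobounded₀, ← Filter.map_inv, eventually_map]
    filter_upwards [h, eventually_ne_cobounded (0 : ℂ)] with z hz hz₀
    rw [μ.stieltjes_eq_stieltjesAtInfty_inv hz₀, ν.stieltjes_eq_stieltjesAtInfty_inv hz₀] at hz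
    exact mul_left_cancel₀ (inv_ne_zero hz₀) hz
  have h_germ : μ.momentSeries =ᶠ[𝓝 0] ν.momentSeries :=
    (μ.hasFPowerSeriesAt_momentSeries.analyticAt.frequently_eq_iff_eventually_eq
      ν.hasFPowerSeriesAt_momentSeries.analyticAt).1 h_ne.frequently
  have h_series := (μ.hasFPowerSeriesAt_momentSeries.congr h_germ).eq_formalMultilinearSeries
    ν.hasFPowerSeriesAt_momentSeries
  refine ext_of_moment fun n ↦ ?_
  simpa only [FormalMultilinearSeries.coeff_ofScalars] using congrArg (·.coeff n) h_series

end CompactProb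

/-! ### `R`-transforms and quantization -/

lemma analyticAt_dslope {𝕜 : Type*} [NontriviallyNormedField 𝕜] {f : 𝕜 → 𝕜} {x : 𝕜}
    (hf : AnalyticAt 𝕜 f x) : AnalyticAt 𝕜 (dslope f x) x :=
  let ⟨_, hp⟩ := hf
  hp.has_fpower_series_dslope_fslope.analyticAt

lemma exists_analyticAt_inv_eq_add_inv {𝕜 : Type*} [NontriviallyNormedField 𝕜] {f : 𝕜 → 𝕜}
    (hf : AnalyticAt 𝕜 f 0) (hf₀ : f 0 = 0) (hf' : deriv f 0 = 1) :
    ∃ R : 𝕜 → 𝕜, AnalyticAt 𝕜 R 0 ∧ ∀ᶠ w in 𝓝[≠] 0, (f w)⁻¹ = R w + w⁻¹ := by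
  have hk : AnalyticAt 𝕜 (dslope f 0) 0 := analyticAt_dslope hf
  have hk₀ : dslope f 0 0 = 1 := by rw [dslope_same, hf']
  have hk_ne : ∀ᶠ w in 𝓝 0, dslope f 0 w ≠ 0 :=
    hk.continuousAt.eventually_ne (hk₀.trans_ne one_ne_zero)
  -- With `k = f w / w`, this is the identity `1 / f - 1 / w = -((k - 1) / w) / k`.
  refine ⟨fun w ↦ -(dslope (dslope f 0) 0 w / dslope f 0 w),
    ((analyticAt_dslope hk).div hk (hk₀.trans_ne one_ne_zero)).neg, ?_⟩
  filter_upwards [self_mem_nhdsWithin, nhdsWithin_le_nhds hk_ne] with w (hw : w ≠ 0) hkw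
  have hfw : f w = w * dslope f 0 w := by simpa [hf₀] using (sub_smul_dslope f 0 w).symm
  have hkw' : dslope f 0 w = w * dslope (dslope f 0) 0 w + 1 := by
    simpa [hf', sub_eq_iff_eq_add] using (sub_smul_dslope (dslope f 0) 0 w).symm
  rw [hfw]
  field_simp
  linear_combination -hkw'

lemma exists_isRTransform (μ : CompactProb) : ∃ R, IsRTransform μ R := by
  have hG := μ.analyticAt_stieltjesAtInfty
  have hG' : deriv μ.stieltjesAtInfty 0 ≠ 0 := μ.deriv_stieltjesAtInfty_zero.trans_ne one_ne_zero
  set f := hG.hasStrictDerivAt.localInverse _ _ _ hG'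
  have hf : AnalyticAt ℂ f 0 := by simpa using hG.analyticAt_localInverse hG'
  have hleft : ∀ᶠ w in 𝓝 (0 : ℂ), f (μ.stieltjesAtInfty w) = w :=
    hG.hasStrictDerivAt.eventually_left_inverse hG'
  have hf' : HasDerivAt f 1 0 := by
    simpa [μ.deriv_stieltjesAtInfty_zero] using
      (hG.hasStrictDerivAt.to_localInverse hG').hasDerivAt
  obtain ⟨R, hR, hfR⟩ := exists_analyticAt_inv_eq_add_inv hf
    (by simpa using hleft.self_of_nhds) hf'.deriv
  refine ⟨R, hR, ?_⟩
  filter_upwards [μ.eventually_nhdsNE_iff.1 hfR, tendsto_inv₀_cobounded.eventually hleft,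
    eventually_ne_cobounded (0 : ℂ)] with z hfz hleftz hz
  rw [← hfz, μ.stieltjes_eq_stieltjesAtInfty_inv hz, hleftz, inv_inv]

namespace IsRTransform

variable {μ ν : CompactProb} {R R' : ℂ → ℂ}

lemma eventuallyEq (h : IsRTransform μ R) (h' : IsRTransform μ R') : R =ᶠ[𝓝[≠] 0] R' := by
  refine μ.eventually_nhdsNE_iff.2 ?_
  filter_upwards [h.2, h'.2] with z hz hz' using add_right_cancel (hz.trans hz'.symm)

lemma eventually_stieltjes_eq (h : IsRTransform μ R) :
    ∀ᶠ w in 𝓝[≠] 0, stieltjes μ (R w + w⁻¹) = w :=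
  μ.eventually_nhdsNE_iff.2 <| h.2.mono fun _ hz ↦ congrArg (stieltjes μ) hz

lemma measure_unique (h : IsRTransform μ R) (h' : IsRTransform ν R') (hR : R =ᶠ[𝓝[≠] 0] R') :
    μ = ν := by
  have hν : ∀ᶠ w in 𝓝[≠] 0, stieltjes ν (R w + w⁻¹) = w := by
    filter_upwards [h'.eventually_stieltjes_eq, hR] with w hw hRw
    rwa [hRw]
  apply CompactProb.ext_of_stieltjes
  filter_upwards [μ.eventually_nhdsNE_iff.1 hν, h.2] with z hνz hz
  rw [← hνz, hz]

end IsRTransform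

namespace IsQuantizedRTransform

variable {q : ℝ} {μ ν : CompactProb} {S S' : ℂ → ℂ}

lemma eventuallyEq (h : IsQuantizedRTransform q μ S) (h' : IsQuantizedRTransform q μ S') :
    S =ᶠ[𝓝[≠] 0] S' := by
  obtain ⟨R, hR, hS⟩ := h
  obtain ⟨R', hR', hS'⟩ := h'
  filter_upwards [hS, hS', hR.eventuallyEq hR'] with w hSw hSw' hRw
  rw [hSw, hSw', hRw]

lemma measure_unique (h : IsQuantizedRTransform q μ S) (h' : IsQuantizedRTransform q ν S')
    (hSS' : S =ᶠ[𝓝[≠] 0] S') : μ = ν := by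
  obtain ⟨R, hR, hS⟩ := h
  obtain ⟨R', hR', hS'⟩ := h'
  refine hR.measure_unique hR' ?_
  filter_upwards [hSS', hS, hS'] with w hw hSw hSw'
  linear_combination hw - hSw + hSw'

end IsQuantizedRTransform

/-- `ν` is the quantization of `μ` with shift `s`: `1 / G_μ(z - s) + s = e_q(w) / (e_q(w) - 1)`
at `w = G_ν(z)`, for all large `z`. This is the common form of `PRelation` (`s = 0`) and
`QRelation` (`s = 1`) that turns free convolution into quantized convolution. -/
def IsQuantization (q : ℝ) (s : ℂ) (μ ν : CompactProb) : Prop :=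
  ∀ᶠ z in cobounded ℂ,
    (stieltjes μ (z - s))⁻¹ + s = qExp q (stieltjes ν z) / (qExp q (stieltjes ν z) - 1)

/-- The function `φ` with `1 / φ + s = e_q / (e_q - 1)`, which is the change of variables from the
quantized `R`-transform to the `R`-transform. -/
noncomputable def quantChange (q : ℝ) (s w : ℂ) : ℂ := (qExp q w / (qExp q w - 1) - s)⁻¹

namespace IsQuantization

variable {q : ℝ} {s : ℂ} {μ ν : CompactProb}

lemma stieltjes_sub_eq (h : IsQuantization q s μ ν) :
    ∀ᶠ z in cobounded ℂ, stieltjes μ (z - s) = quantChange q s (stieltjes ν z) :=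
  h.mono fun z hz ↦ by rw [quantChange, ← hz, add_sub_cancel_right, inv_inv]

lemma tendsto_quantChange (h : IsQuantization q s μ ν) :
    Tendsto (quantChange q s) (𝓝[≠] 0) (𝓝 0) := by
  rw [← ν.map_stieltjes, tendsto_map'_iff]
  exact (μ.tendsto_stieltjes_nhds.comp (tendsto_sub_const_cobounded s)).congr' h.stieltjes_sub_eq

lemma isQuantizedRTransform (h : IsQuantization q s μ ν) {R : ℂ → ℂ} (hR : IsRTransform μ R) :
    IsQuantizedRTransform q ν (R ∘ quantChange q s) := by
  obtain ⟨R', hR'⟩ := exists_isRTransform ν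
  refine ⟨R', hR', ν.eventually_nhdsNE_iff.2 ?_⟩
  filter_upwards [h, h.stieltjes_sub_eq, hR'.2,
    (tendsto_sub_const_cobounded s).eventually hR.2] with z hz hφ hνz hμz
  rw [← hz, Function.comp_apply, ← hφ, one_div]
  linear_combination hμz - hνz

end IsQuantization

lemma IsFreeConvolution.isQuantizedConvolution_iff {q : ℝ} {s : ℂ} {μ₁ μ₂ μ ν₁ ν₂ ν : CompactProb}
    (hμ : IsFreeConvolution μ₁ μ₂ μ) (h₁ : IsQuantization q s μ₁ ν₁)
    (h₂ : IsQuantization q s μ₂ ν₂) (h : IsQuantization q s μ ν) (ρ : CompactProb) :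
    IsQuantizedConvolution q ν₁ ν₂ ρ ↔ ρ = ν := by
  obtain ⟨R₁, R₂, R, hR₁, hR₂, hR, hadd⟩ := hμ
  have hS₁ := h₁.isQuantizedRTransform hR₁
  have hS₂ := h₂.isQuantizedRTransform hR₂
  have hS := h.isQuantizedRTransform hR
  have hadd_comp := h.tendsto_quantChange.eventually hadd
  constructor
  · rintro ⟨S₁, S₂, S, hS₁', hS₂', hS', hsum⟩
    refine hS'.measure_unique hS ?_
    filter_upwards [hsum, hS₁'.eventuallyEq hS₁, hS₂'.eventuallyEq hS₂, hadd_comp]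
      with w hw hw₁ hw₂ hwR
    rw [hw, hw₁, hw₂, Function.comp_apply, Function.comp_apply, Function.comp_apply, hwR]
  · rintro rfl
    exact ⟨_, _, _, hS₁, hS₂, hS, hadd_comp⟩

/-! ### The `q`-logarithm -/

lemma eventually_cpow_cpow (a b : ℂ) : ∀ᶠ x in 𝓝 (1 : ℂ), (x ^ a) ^ b = x ^ (a * b) := by
  have hlim : Tendsto (fun x : ℂ ↦ (Complex.log x * a).im) (𝓝 1) (𝓝 0) := by
    have hlog : ContinuousAt Complex.log 1 := continuousAt_clog Complex.one_mem_slitPlane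
    simpa using! Complex.continuous_im.continuousAt.tendsto.comp (hlog.mul_const a)
  filter_upwards [hlim.eventually_const_lt (neg_lt_zero.2 Real.pi_pos),
    hlim.eventually_lt_const Real.pi_pos] with x hx hx'
  rw [Complex.cpow_mul _ hx hx'.le]

/-- The logarithm `(1 - x ^ (-q)) / q`, inverse to the `q`-exponential near `1`. -/
noncomputable def qLog (q : ℝ) (x : ℂ) : ℂ := (1 - x ^ (-(q : ℂ))) / q

lemma qLog_inv (q : ℝ) {x : ℂ} (hx : x.arg ≠ Real.pi) : qLog q x⁻¹ = -qLog (-q) x := by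
  rw [qLog, qLog, Complex.inv_cpow _ _ hx, Complex.cpow_neg, inv_inv, Complex.ofReal_neg, neg_neg,
    div_neg, neg_neg]

lemma eventually_qLog_qExp {q : ℝ} (hq : q ≠ 0) : ∀ᶠ w in 𝓝 (0 : ℂ), qLog q (qExp q w) = w := by
  have hqC : (q : ℂ) ≠ 0 := Complex.ofReal_ne_zero.2 hq
  have hlim : Tendsto (fun w : ℂ ↦ 1 - q * w) (𝓝 0) (𝓝 1) :=
    Continuous.tendsto' (by fun_prop) _ _ (by simp)
  filter_upwards [hlim.eventually (eventually_cpow_cpow (-1 / q) (-q))] with w hw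
  rw [qLog, qExp, hw, show (-1 / q * -q : ℂ) = 1 by field_simp, Complex.cpow_one, sub_sub_cancel,
    mul_div_cancel_left₀ _ hqC]

lemma eventually_qExp_qLog {q : ℝ} (hq : q ≠ 0) : ∀ᶠ x in 𝓝 (1 : ℂ), qExp q (qLog q x) = x := by
  have hqC : (q : ℂ) ≠ 0 := Complex.ofReal_ne_zero.2 hq
  filter_upwards [eventually_cpow_cpow (-q) (-1 / q)] with x hx
  rw [qExp, qLog, mul_div_cancel₀ _ hqC, sub_sub_cancel, hx,
    show (-q * (-1 / q) : ℂ) = 1 by field_simp, Complex.cpow_one]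

lemma eventually_qExp_eq_iff {q : ℝ} (hq : q ≠ 0) {α : Type*} {l : Filter α} {f g : α → ℂ}
    (hf : Tendsto f l (𝓝 0)) (hg : Tendsto g l (𝓝 1)) :
    (∀ᶠ z in l, qExp q (f z) = g z) ↔ ∀ᶠ z in l, f z = qLog q (g z) := by
  refine eventually_congr ?_
  filter_upwards [hf.eventually (eventually_qLog_qExp hq), hg.eventually (eventually_qExp_qLog hq)]
    with z hfz hgz
  exact ⟨fun h ↦ by rw [← h, hfz], fun h ↦ by rw [h, hgz]⟩

section Relations

variable {q : ℝ} {μ ν : CompactProb}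

lemma pRelation_iff_qExp :
    PRelation q μ ν ↔ ∀ᶠ z in cobounded ℂ, qExp q (stieltjes ν z) = (1 - stieltjes μ z)⁻¹ := by
  refine eventually_congr (.of_forall fun z ↦ ?_)
  rw [qExp, neg_div, Complex.cpow_neg, inv_inj, eq_comm]

lemma qRelation_iff_qExp :
    QRelation q μ ν ↔ ∀ᶠ z in cobounded ℂ, qExp q (stieltjes ν z) = 1 + stieltjes μ (z - 1) :=
  eventually_congr (.of_forall fun _ ↦ eq_comm)

lemma pRelation_iff_qLog (hq : q ≠ 0) :
    PRelation q μ ν ↔ ∀ᶠ z in cobounded ℂ, stieltjes ν z = qLog q (1 - stieltjes μ z)⁻¹ := by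
  refine pRelation_iff_qExp.trans <| eventually_qExp_eq_iff hq ν.tendsto_stieltjes_nhds ?_
  simpa using (μ.tendsto_stieltjes_nhds.const_sub 1).inv₀ (by simp)

lemma qRelation_iff_qLog (hq : q ≠ 0) :
    QRelation q μ ν ↔ ∀ᶠ z in cobounded ℂ, stieltjes ν z = qLog q (1 + stieltjes μ (z - 1)) := by
  refine qRelation_iff_qExp.trans <| eventually_qExp_eq_iff hq ν.tendsto_stieltjes_nhds ?_
  simpa using (μ.tendsto_stieltjes_nhds.comp (tendsto_sub_const_cobounded 1)).const_add 1

lemma PRelation.isQuantization (h : PRelation q μ ν) : IsQuantization q 0 μ ν := by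
  filter_upwards [pRelation_iff_qExp.1 h,
    μ.tendsto_stieltjes_nhds.eventually_ne zero_ne_one] with z hz hG
  have hG' : 1 - stieltjes μ z ≠ 0 := sub_ne_zero.2 hG.symm
  have hsub : (1 - stieltjes μ z)⁻¹ - 1 = stieltjes μ z * (1 - stieltjes μ z)⁻¹ := by
    field_simp
    ring
  rw [hz, sub_zero, add_zero, hsub, div_mul_cancel_right₀ (inv_ne_zero hG')]

lemma QRelation.isQuantization (h : QRelation q μ ν) : IsQuantization q 1 μ ν := by
  filter_upwards [qRelation_iff_qExp.1 h,
    (tendsto_sub_const_cobounded 1).eventually μ.eventually_stieltjes_ne_zero] with z hz hG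
  rw [hz, add_sub_cancel_left, add_div, div_self hG, one_div]

lemma PRelation.right_unique (hq : q ≠ 0) {ν' : CompactProb} (h : PRelation q μ ν)
    (h' : PRelation q μ ν') : ν = ν' := by
  apply CompactProb.ext_of_stieltjes
  filter_upwards [(pRelation_iff_qLog hq).1 h, (pRelation_iff_qLog hq).1 h'] with z hz hz'
  rw [hz, hz']

lemma QRelation.right_unique (hq : q ≠ 0) {ν' : CompactProb} (h : QRelation q μ ν)
    (h' : QRelation q μ ν') : ν = ν' := by
  apply CompactProb.ext_of_stieltjes
  filter_upwards [(qRelation_iff_qLog hq).1 h, (qRelation_iff_qLog hq).1 h'] with z hz hz'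
  rw [hz, hz']

lemma PRelation.left_unique {μ' : CompactProb} (h : PRelation q μ ν)
    (h' : PRelation q μ' ν) : μ = μ' := by
  apply CompactProb.ext_of_stieltjes
  filter_upwards [h, h'] with z hz hz'
  exact sub_right_injective (hz.trans hz'.symm)

lemma QRelation.left_unique {μ' : CompactProb} (h : QRelation q μ ν)
    (h' : QRelation q μ' ν) : μ = μ' := by
  apply CompactProb.ext_of_stieltjes
  filter_upwards [(tendsto_add_const_cobounded 1).eventually (h.and h')] with z hz
  simpa only [add_sub_cancel_right, add_right_inj] using hz.1.trans hz.2.symm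

end Relations

/-! ### The beta law -/

section Beta

open ProbabilityTheory

variable {α β : ℝ}

lemma ae_mem_Icc_betaMeasure (α β : ℝ) : ∀ᵐ t ∂betaMeasure α β, t ∈ Set.Icc 0 1 := by
  refine (ae_withDensity_iff (measurable_betaPDFReal α β).ennreal_ofReal).2
    (.of_forall fun t ht ↦ ?_)
  by_contra hmem
  rcases not_and_or.1 hmem with h | h
  · exact ht (betaPDF_eq_zero_of_nonpos (not_le.1 h).le)
  · exact ht (betaPDF_eq_zero_of_one_le (not_le.1 h).le)

/-- The beta distribution, as a compactly supported probability measure. -/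
noncomputable def betaProb (hα : 0 < α) (hβ : 0 < β) : CompactProb :=
  haveI := isProbabilityMeasureBeta hα hβ
  .ofAE (betaMeasure α β) isCompact_Icc (ae_mem_Icc_betaMeasure α β)

lemma betaPDFReal_nonneg (hα : 0 < α) (hβ : 0 < β) (t : ℝ) : 0 ≤ betaPDFReal α β t := by
  by_cases ht : 0 < t ∧ t < 1
  · exact (betaPDFReal_pos ht.1 ht.2 hα hβ).le
  · rw [betaPDFReal, if_neg ht]

lemma integral_betaPDFReal (hα : 0 < α) (hβ : 0 < β) : ∫ t, betaPDFReal α β t = 1 := by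
  rw [integral_eq_lintegral_of_nonneg_ae (.of_forall (betaPDFReal_nonneg hα hβ))
    (measurable_betaPDFReal α β).aestronglyMeasurable]
  exact (ENNReal.toReal_eq_one_iff _).2 (lintegral_betaPDF_eq_one hα hβ)

lemma betaPDFReal_mul_pow (hα : 0 < α) (hβ : 0 < β) (n : ℕ) (t : ℝ) :
    betaPDFReal α β t * t ^ n = beta (α + n) β / beta α β * betaPDFReal (α + n) β t := by
  have hne := (beta_pos (by positivity : 0 < α + n) hβ).ne'
  by_cases ht : 0 < t ∧ t < 1
  · rw [betaPDFReal, betaPDFReal, if_pos ht, if_pos ht, add_sub_right_comm,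
      Real.rpow_add_natCast ht.1.ne']
    field_simp
  · rw [betaPDFReal, betaPDFReal, if_neg ht, if_neg ht, zero_mul, mul_zero]

lemma beta_add_natCast_div (hα : 0 < α) (hβ : 0 < β) (n : ℕ) :
    ((beta (α + n) β / beta α β : ℝ) : ℂ) =
      (ascPochhammer ℂ n).eval (α : ℂ) / (ascPochhammer ℂ n).eval (α + β : ℂ) := by
  have hpoch {x : ℝ} (hx : 0 < x) : (ascPochhammer ℂ n).eval (x : ℂ) =
      ((Real.Gamma (x + n) / Real.Gamma x : ℝ) : ℂ) := by
    rw [← Complex.Gamma_add_nat_div_Gamma_eq _ fun k hk ↦ ?_]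
    · push_cast [← Complex.Gamma_ofReal]
      rfl
    · have : x = -k := by exact_mod_cast hk
      linarith [k.cast_nonneg (α := ℝ)]
  rw [← Complex.ofReal_add, hpoch hα, hpoch (add_pos hα hβ), ← Complex.ofReal_div, beta, beta,
    add_right_comm]
  have h₁ := (Real.Gamma_pos_of_pos hα).ne'
  have h₂ := (Real.Gamma_pos_of_pos hβ).ne'
  have h₃ := (Real.Gamma_pos_of_pos (add_pos hα hβ)).ne'
  have h₄ := (Real.Gamma_pos_of_pos (by positivity : 0 < α + β + n)).ne'
  congr 1
  field_simp

lemma moment_betaProb (hα : 0 < α) (hβ : 0 < β) (n : ℕ) :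
    (betaProb hα hβ).moment n =
      (ascPochhammer ℂ n).eval (α : ℂ) / (ascPochhammer ℂ n).eval (α + β : ℂ) := by
  have hint : ∫ t, t ^ n ∂betaMeasure α β = beta (α + n) β / beta α β := by
    have hmeas : Measurable (betaPDF α β) := (measurable_betaPDFReal α β).ennreal_ofReal
    rw [betaMeasure, integral_withDensity_eq_integral_toReal_smul hmeas
      (.of_forall fun _ ↦ ENNReal.ofReal_lt_top)]
    simp only [ENNReal.toReal_ofReal (betaPDFReal_nonneg hα hβ _), smul_eq_mul, betaPDF,
      betaPDFReal_mul_pow hα hβ]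
    rw [integral_const_mul, integral_betaPDFReal (by positivity) hβ, mul_one]
  rw [← beta_add_natCast_div hα hβ, ← hint, ← integral_complex_ofReal]
  simp only [Complex.ofReal_pow]
  rfl

end Beta

lemma choose_add_natCast_sub_one_eq (a : ℂ) (n : ℕ) :
    Ring.choose (a + n - 1) n = (ascPochhammer ℂ n).eval a / (n ! : ℂ) := by
  rw [← Ring.multichoose_eq, eq_div_iff (by exact_mod_cast n.factorial_ne_zero),
    ← Polynomial.ascPochhammer_smeval_eq_eval, ← Ring.factorial_nsmul_multichoose_eq_ascPochhammer,
    nsmul_eq_mul, mul_comm]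

lemma hasFPowerSeriesAt_one_sub_cpow (a : ℂ) :
    HasFPowerSeriesAt (fun x : ℂ ↦ (1 - x) ^ a)
      (.ofScalars ℂ fun n ↦ (ascPochhammer ℂ n).eval (-a) / (n ! : ℂ)) 0 := by
  simpa [Complex.cpow_neg, choose_add_natCast_sub_one_eq] using
    (Complex.one_div_one_sub_cpow_hasFPowerSeriesOnBall_zero (-a)).hasFPowerSeriesAt

lemma ascPochhammer_succ_eval_neg_div_factorial {R : Type*} [Field R] (a : R) (n : ℕ) :
    (ascPochhammer R (n + 1)).eval (-a) / ((n + 1)! : R) =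
      -a * ((ascPochhammer R n).eval (1 - a) / (ascPochhammer R n).eval 2) := by
  have hfact : ((n + 1)! : R) = (ascPochhammer R n).eval 2 := by
    simp [Nat.cast_factorial R, ascPochhammer_succ_left, one_add_one_eq_two]
  rw [hfact]
  simp only [ascPochhammer_succ_left, Polynomial.eval_mul, Polynomial.eval_X, Polynomial.eval_comp,
    Polynomial.eval_add, Polynomial.eval_one, neg_add_eq_sub, mul_div_assoc]

lemma eventually_one_sub_cpow_eq {q : ℝ} (hq₁ : 0 < 1 - q) (hq₂ : 0 < 1 + q) :
    ∀ᶠ w in 𝓝 (0 : ℂ), (1 - w) ^ (q : ℂ) =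
      1 - q * (betaProb hq₁ hq₂).stieltjesAtInfty w := by
  filter_upwards [hasFPowerSeriesAt_iff.1 (hasFPowerSeriesAt_one_sub_cpow q),
    hasFPowerSeriesAt_iff.1 (betaProb hq₁ hq₂).hasFPowerSeriesAt_momentSeries] with w hpow hmom
  simp only [FormalMultilinearSeries.coeff_ofScalars, smul_eq_mul, zero_add] at hpow hmom
  have hcoeff (n : ℕ) : (ascPochhammer ℂ (n + 1)).eval (-(q : ℂ)) / ((n + 1)! : ℂ) =
      -q * (betaProb hq₁ hq₂).moment n := by
    rw [ascPochhammer_succ_eval_neg_div_factorial, moment_betaProb]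
    push_cast
    ring_nf
  have htail := (hasSum_nat_add_iff' 1).2 hpow
  simp only [hcoeff, Finset.sum_range_one] at htail
  have htail_eq := htail.unique ((hmom.mul_left (-q * w)).congr_fun fun n ↦ by ring)
  simp only [pow_zero, ascPochhammer_zero, Polynomial.eval_one, Nat.factorial_zero, Nat.cast_one,
    div_one, mul_one, CompactProb.stieltjesAtInfty] at htail_eq ⊢
  linear_combination htail_eq

lemma eventually_stieltjes_betaProb_inv {q : ℝ} (hq : q ≠ 0) (hq₁ : 0 < 1 - q) (hq₂ : 0 < 1 + q) :
    ∀ᶠ g in 𝓝[≠] (0 : ℂ), stieltjes (betaProb hq₁ hq₂) g⁻¹ = -qLog (-q) (1 - g) := by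
  have hqC : (q : ℂ) ≠ 0 := by exact_mod_cast hq
  filter_upwards [(eventually_one_sub_cpow_eq hq₁ hq₂).filter_mono nhdsWithin_le_nhds,
    self_mem_nhdsWithin] with g hg hg₀
  rw [CompactProb.stieltjes_eq_stieltjesAtInfty_inv _ (inv_ne_zero hg₀), inv_inv, qLog,
    Complex.ofReal_neg, neg_neg, hg]
  field_simp
  ring

/-! ### Spectral measures -/

section SpectralMeasure

open scoped ComplexOrder in
lemma im_apply_realToRCLike_eq_zero {X : Type*} [TopologicalSpace X] (Λ : C(X, ℂ) →ₗ[ℂ] ℂ)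
    (hΛ : ∀ f, 0 ≤ f → 0 ≤ Λ f) (g : C(X, ℝ)) : (Λ (g.realToRCLike ℂ)).im = 0 := by
  have hpos {g : C(X, ℝ)} (hg : 0 ≤ g) : (Λ (g.realToRCLike ℂ)).im = 0 :=
    (Complex.nonneg_iff.1 <| hΛ _ <| ContinuousMap.le_def.2 fun x ↦
      Complex.zero_le_real.2 (hg x)).2.symm
  have hsub : g.realToRCLike ℂ =
      (g⁺ : C(X, ℝ)).realToRCLike ℂ - (g⁻ : C(X, ℝ)).realToRCLike ℂ := by
    conv_lhs => rw [← posPart_sub_negPart g]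
    ext x
    exact Complex.ofReal_sub _ _
  rw [hsub, map_sub, Complex.sub_im, hpos (posPart_nonneg g), hpos (negPart_nonneg g), sub_zero]

open scoped ComplexOrder in
lemma exists_measure_integral_eq_of_nonneg {X : Type*} [TopologicalSpace X] [T2Space X]
    [CompactSpace X] [MeasurableSpace X] [BorelSpace X] (Λ : C(X, ℂ) →ₗ[ℂ] ℂ)
    (hΛ : ∀ f, 0 ≤ f → 0 ≤ Λ f) :
    ∃ ν : Measure X, IsFiniteMeasure ν ∧ ∀ f : C(X, ℂ), ∫ x, f x ∂ν = Λ f := by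
  let Λ₀ : C_c(X, ℝ) →ₗ[ℝ] ℝ :=
    { toFun := fun g ↦ (Λ ((g : C(X, ℝ)).realToRCLike ℂ)).re
      map_add' := fun g g' ↦ by
        rw [← Complex.add_re, ← map_add]
        congr 3
        ext x
        simp
      map_smul' := fun c g ↦ by
        rw [RingHom.id_apply, smul_eq_mul, ← Complex.re_ofReal_mul, ← smul_eq_mul (c : ℂ),
          ← map_smul]
        congr 3
        ext x
        simp }
  let Λ' : C_c(X, ℝ) →ₚ[ℝ] ℝ := PositiveLinearMap.mk₀ Λ₀ fun g hg ↦
    (Complex.nonneg_iff.1 <| hΛ _ <| ContinuousMap.le_def.2 fun x ↦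
      Complex.zero_le_real.2 (hg x)).1
  have hreal (g : C(X, ℝ)) : ∫ x, g x ∂(RealRMK.rieszMeasure Λ') = Λ (g.realToRCLike ℂ) := by
    rw [← Complex.re_add_im (Λ _), im_apply_realToRCLike_eq_zero Λ hΛ g]
    simpa using! RealRMK.integral_rieszMeasure Λ' ⟨g, .of_compactSpace _⟩
  refine ⟨RealRMK.rieszMeasure Λ', inferInstance, fun f ↦ ?_⟩
  have hint : Integrable f (RealRMK.rieszMeasure Λ') :=
    f.continuous.integrable_of_hasCompactSupport (.of_compactSpace _)
  let re : C(X, ℝ) := ⟨fun x ↦ (f x).re, by fun_prop⟩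
  let im : C(X, ℝ) := ⟨fun x ↦ (f x).im, by fun_prop⟩
  have hf : f = re.realToRCLike ℂ + Complex.I • im.realToRCLike ℂ := by
    ext x
    simp [re, im, mul_comm Complex.I, Complex.re_add_im]
  conv_rhs => rw [hf, map_add, map_smul, ← hreal re, ← hreal im, smul_eq_mul, mul_comm]
  exact (integral_re_add_im hint).symm

variable {H : Type*} [NormedAddCommGroup H] [InnerProductSpace ℂ H] [CompleteSpace H]

open scoped ComplexOrder in
lemma exists_spectralMeasure (T : H →L[ℂ] H) [IsStarNormal T] (v : H) :
    ∃ ν : Measure ℂ, IsFiniteMeasure ν ∧ (∀ᵐ z ∂ν, z ∈ spectrum ℂ T) ∧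
      ∀ f : ℂ → ℂ, ContinuousOn f (spectrum ℂ T) → ∫ z, f z ∂ν = ⟪v, cfc f T v⟫_ℂ := by
  have hcompact : IsCompact (spectrum ℂ T) := spectrum.isCompact T
  have : CompactSpace (spectrum ℂ T) := isCompact_iff_compactSpace.1 hcompact
  let Φ : C(spectrum ℂ T, ℂ) →⋆ₐ[ℂ] (H →L[ℂ] H) := cfcHom ‹IsStarNormal T›
  let Λ : C(spectrum ℂ T, ℂ) →ₗ[ℂ] ℂ :=
    { toFun := fun f ↦ ⟪v, Φ f v⟫_ℂ
      map_add' := fun f g ↦ by simp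
      map_smul' := fun c f ↦ by simp }
  have hΛ (f : C(spectrum ℂ T, ℂ)) (hf : 0 ≤ f) : 0 ≤ Λ f :=
    ((ContinuousLinearMap.nonneg_iff_isPositive _).1 <|
      (cfcHom_nonneg_iff ‹IsStarNormal T›).2 hf).inner_nonneg_right v
  obtain ⟨ν, hfin, hν⟩ := exists_measure_integral_eq_of_nonneg Λ hΛ
  have hK : MeasurableSet (spectrum ℂ T) := hcompact.measurableSet
  refine ⟨ν.map Subtype.val, inferInstance, ?_, fun f hf ↦ ?_⟩
  · exact (ae_map_iff measurable_subtype_coe.aemeasurable hK).2 (.of_forall Subtype.prop)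
  · rw [(MeasurableEmbedding.subtype_coe hK).integral_map, cfc_apply f T]
    exact hν ⟨_, continuousOn_iff_continuous_domRestrict.1 hf⟩

lemma cfc_inv_sub_apply {T : H →L[ℂ] H} [IsStarNormal T] {z : ℂ} (hz : z ∉ spectrum ℂ T) {v w : H}
    (hw : z • w - T w = v) : cfc (fun s ↦ (z - s)⁻¹) T v = w := by
  have hne : ∀ s ∈ spectrum ℂ T, z - s ≠ 0 := fun s hs h ↦ hz (sub_eq_zero.1 h ▸ hs)
  have hinv : cfc (fun s ↦ (z - s)⁻¹) T * cfc (fun s ↦ z - s) T = 1 := by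
    rw [← cfc_mul (fun s ↦ (z - s)⁻¹) (fun s ↦ z - s) T
      (ContinuousOn.inv₀ (by fun_prop) hne) (by fun_prop), ← cfc_const_one ℂ T]
    exact cfc_congr fun s hs ↦ inv_mul_cancel₀ (hne s hs)
  have hsub : cfc (fun s ↦ z - s) T = algebraMap ℂ _ z - T := by
    rw [cfc_sub (fun _ ↦ z) (fun s ↦ s) T, cfc_const z T, cfc_id' ℂ T]
  rw [hsub] at hinv
  rw [← hw]
  simpa [Algebra.algebraMap_eq_smul_one] using DFunLike.congr_fun hinv w

lemma exists_stieltjes_eq_inner {T : H →L[ℂ] H} (hT : IsSelfAdjoint T) {v : H} (hv : ‖v‖ = 1) :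
    ∃ ν : CompactProb, ∀ z ∉ spectrum ℂ T, ∀ w, z • w - T w = v → stieltjes ν z = ⟪v, w⟫_ℂ := by
  have := hT.isStarNormal
  obtain ⟨ν, _, hmem, hν⟩ := exists_spectralMeasure T v
  have hprob : IsProbabilityMeasure ν := by
    have hone := hν 1 continuousOn_const
    rw [cfc_one ℂ T] at hone
    have : ν.real Set.univ = 1 := by
      simpa [inner_self_eq_norm_sq_to_K, hv] using hone
    exact isProbabilityMeasure_iff_real.2 this
  have := Measure.isProbabilityMeasure_map (μ := ν) Complex.measurable_re.aemeasurable
  have hcompact := (spectrum.isCompact (𝕜 := ℂ) T).image Complex.continuous_re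
  refine ⟨.ofAE (ν.map Complex.re) hcompact ?_, fun z hz w hw ↦ ?_⟩
  · exact (ae_map_iff Complex.measurable_re.aemeasurable hcompact.measurableSet).2 <|
      hmem.mono fun s ↦ Set.mem_image_of_mem _
  · have hcont : ContinuousOn (fun s ↦ (z - s)⁻¹) (spectrum ℂ T) :=
      ContinuousOn.inv₀ (by fun_prop) fun s hs h ↦ hz (sub_eq_zero.1 h ▸ hs)
    rw [← cfc_inv_sub_apply hz hw, ← hν _ hcont]
    refine (integral_map Complex.measurable_re.aemeasurable
      (by fun_prop)).trans (integral_congr_ae ?_)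
    filter_upwards [hmem] with s hs
    rw [← hT.mem_spectrum_eq_re hs]

end SpectralMeasure

/-! ### Monotone convolution -/

section MulL2

variable {α : Type*} [MeasurableSpace α] {μ : Measure α} {f g : α → ℂ}

/-- The operator of multiplication by an essentially bounded function on `L²`. -/
noncomputable def mulL2 (hf : MemLp f ⊤ μ) : Lp ℂ 2 μ →L[ℂ] Lp ℂ 2 μ :=
  (ContinuousLinearMap.mul ℂ ℂ).holderL μ ⊤ 2 2 hf.toLp

lemma coeFn_mulL2 (hf : MemLp f ⊤ μ) (ξ : Lp ℂ 2 μ) : mulL2 hf ξ =ᵐ[μ] fun x ↦ f x * ξ x := by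
  filter_upwards [(ContinuousLinearMap.mul ℂ ℂ).coeFn_holder (r := 2) hf.toLp ξ, hf.coeFn_toLp]
    with x hx hfx
  rw [mulL2, ContinuousLinearMap.holderL_apply_apply, hx, hfx, ContinuousLinearMap.mul_apply']

lemma isSelfAdjoint_mulL2 (hf : MemLp f ⊤ μ) (hreal : ∀ x, star (f x) = f x) :
    IsSelfAdjoint (mulL2 hf) := by
  rw [ContinuousLinearMap.isSelfAdjoint_iff_isSymmetric]
  intro ξ η
  simp only [ContinuousLinearMap.coe_coe, L2.inner_def]
  apply integral_congr_ae
  filter_upwards [coeFn_mulL2 hf ξ, coeFn_mulL2 hf η] with x hξ hη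
  rw [hξ, hη, RCLike.inner_apply, RCLike.inner_apply, map_mul, starRingEnd_apply, hreal]
  ring

lemma smul_sub_mulL2_mulL2 (hf : MemLp f ⊤ μ) (hg : MemLp g ⊤ μ) {z : ℂ}
    (h : ∀ᵐ x ∂μ, (z - f x) * g x = 1) (ξ : Lp ℂ 2 μ) :
    z • mulL2 hg ξ - mulL2 hf (mulL2 hg ξ) = ξ := by
  apply Lp.ext
  filter_upwards [Lp.coeFn_sub (z • mulL2 hg ξ) (mulL2 hf (mulL2 hg ξ)),
    Lp.coeFn_smul z (mulL2 hg ξ), coeFn_mulL2 hg ξ, coeFn_mulL2 hf (mulL2 hg ξ), h]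
    with x hsub hsmul hgx hfx hx
  rw [hsub, Pi.sub_apply, hsmul, Pi.smul_apply, hfx, hgx, smul_eq_mul]
  linear_combination ξ x * hx

lemma inner_const_one_mulL2_const_one [IsFiniteMeasure μ] (hf : MemLp f ⊤ μ) :
    ⟪Lp.const 2 μ (1 : ℂ), mulL2 hf (Lp.const 2 μ 1)⟫_ℂ = ∫ x, f x ∂μ := by
  rw [L2.inner_def]
  apply integral_congr_ae
  filter_upwards [Lp.coeFn_const 2 μ (1 : ℂ), coeFn_mulL2 hf (Lp.const 2 μ 1)] with x h₁ hfx
  rw [hfx, RCLike.inner_apply, h₁, Function.const_apply, map_one, mul_one, mul_one]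

end MulL2

section Lift

variable {α β : Type*} [MeasurableSpace α] [MeasurableSpace β] (κ : Measure α)
  (μ : Measure β) [IsProbabilityMeasure μ]

/-- The isometric embedding of `L²(κ)` into `L²(κ ⊗ μ)` by functions of the first coordinate. -/
noncomputable def liftFst : Lp ℂ 2 κ →L[ℂ] Lp ℂ 2 (κ.prod μ) :=
  (Lp.compMeasurePreservingₗᵢ ℂ Prod.fst measurePreserving_fst).toContinuousLinearMap

lemma coeFn_liftFst (ξ : Lp ℂ 2 κ) : liftFst κ μ ξ =ᵐ[κ.prod μ] fun p ↦ ξ p.1 :=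
  Lp.coeFn_compMeasurePreserving _ _

lemma norm_liftFst (ξ : Lp ℂ 2 κ) : ‖liftFst κ μ ξ‖ = ‖ξ‖ :=
  (Lp.compMeasurePreservingₗᵢ ℂ Prod.fst measurePreserving_fst).norm_map ξ

variable {κ μ}

lemma adjoint_liftFst_mulL2 [IsProbabilityMeasure κ] {g : β → ℂ} (hg : MemLp g ⊤ μ)
    (ξ : Lp ℂ 2 κ) :
    (liftFst κ μ).adjoint (mulL2 (hg.comp_measurePreserving (measurePreserving_snd (μ := κ)))
      (liftFst κ μ ξ)) = (∫ t, g t ∂μ) • ξ := by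
  have hg_snd := hg.comp_measurePreserving (measurePreserving_snd (μ := κ))
  refine ext_inner_left ℂ fun η ↦ ?_
  rw [ContinuousLinearMap.adjoint_inner_right, inner_smul_right, L2.inner_def, L2.inner_def,
    mul_comm, ← integral_prod_mul]
  apply integral_congr_ae
  filter_upwards [coeFn_liftFst κ μ η, coeFn_liftFst κ μ ξ, coeFn_mulL2 hg_snd (liftFst κ μ ξ)]
    with p hη hξ hgp
  rw [hη, hgp, hξ, RCLike.inner_apply, RCLike.inner_apply, Function.comp_apply]
  ring

end Lift

lemma smul_sub_add_conj_apply {H K : Type*} [NormedAddCommGroup H] [InnerProductSpace ℂ H]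
    [CompleteSpace H] [NormedAddCommGroup K] [InnerProductSpace ℂ K] [CompleteSpace K]
    {A : H →L[ℂ] H} {B : K →L[ℂ] K} {J : K →L[ℂ] H} {z G : ℂ} (hG : G ≠ 0) {v b : K} {y : H}
    (hb : G⁻¹ • b - B b = v) (hy : z • y - A y = J b) (hJy : J.adjoint y = G • b) :
    z • (G⁻¹ • y) - (A + J ∘L B ∘L J.adjoint) (G⁻¹ • y) = J v := by
  have hadj : J.adjoint (G⁻¹ • y) = b := by rw [map_smul, hJy, inv_smul_smul₀ hG]
  calc z • (G⁻¹ • y) - (A + J ∘L B ∘L J.adjoint) (G⁻¹ • y)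
      = G⁻¹ • (z • y - A y) - J (B b) := by
        rw [add_apply, ContinuousLinearMap.comp_apply, ContinuousLinearMap.comp_apply, hadj,
          map_smul, smul_comm, smul_sub, sub_sub]
    _ = J v := by rw [hy, ← map_smul, ← map_sub, hb]

section MonotoneSum

variable {α β : Type*} [MeasurableSpace α] [MeasurableSpace β] {κ : Measure α}
  [IsProbabilityMeasure κ] {μ : Measure β} [IsProbabilityMeasure μ] {f : α → ℂ} {g : β → ℂ}

/-- The operator `J M_f J* + M_g` on `L²(κ ⊗ μ)`, where `J` is `liftFst`. In the vector state of
the constant function `1`, its summands are monotonically independent copies of `f` and `g`. -/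
noncomputable def monotoneSum (hf : MemLp f ⊤ κ) (hg : MemLp g ⊤ μ) :
    Lp ℂ 2 (κ.prod μ) →L[ℂ] Lp ℂ 2 (κ.prod μ) :=
  mulL2 (hg.comp_measurePreserving (measurePreserving_snd (μ := κ))) +
    liftFst κ μ ∘L mulL2 hf ∘L (liftFst κ μ).adjoint

lemma isSelfAdjoint_monotoneSum (hf : MemLp f ⊤ κ) (hg : MemLp g ⊤ μ)
    (hf' : ∀ x, star (f x) = f x) (hg' : ∀ t, star (g t) = g t) :
    IsSelfAdjoint (monotoneSum hf hg) :=
  (isSelfAdjoint_mulL2 _ fun p ↦ hg' p.2).add ((isSelfAdjoint_mulL2 hf hf').conj_adjoint _)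

lemma exists_smul_sub_monotoneSum_eq (hf : MemLp f ⊤ κ) (hg : MemLp g ⊤ μ) {z G : ℂ} (hG : G ≠ 0)
    (hG_eq : ∫ t, (z - g t)⁻¹ ∂μ = G) (hz : MemLp (fun t ↦ (z - g t)⁻¹) ⊤ μ)
    (hz' : ∀ᵐ t ∂μ, z - g t ≠ 0) (hGinv : MemLp (fun x ↦ (G⁻¹ - f x)⁻¹) ⊤ κ)
    (hGinv' : ∀ᵐ x ∂κ, G⁻¹ - f x ≠ 0) :
    ∃ w, z • w - monotoneSum hf hg w = liftFst κ μ (Lp.const 2 κ 1) ∧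
      ⟪liftFst κ μ (Lp.const 2 κ 1), w⟫_ℂ = ∫ x, (G⁻¹ - f x)⁻¹ ∂κ := by
  have hsnd : MeasurePreserving Prod.snd (κ.prod μ) μ := measurePreserving_snd
  have hz_snd := hz.comp_measurePreserving hsnd
  have hb := smul_sub_mulL2_mulL2 hf hGinv (hGinv'.mono fun _ ↦ mul_inv_cancel₀) (Lp.const 2 κ 1)
  set b := mulL2 hGinv (Lp.const 2 κ 1)
  have hy := smul_sub_mulL2_mulL2 (hg.comp_measurePreserving hsnd) hz_snd (z := z)
    (hsnd.quasiMeasurePreserving.ae (hz'.mono fun _ ↦ mul_inv_cancel₀)) (liftFst κ μ b)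
  have hJ : (liftFst κ μ).adjoint (mulL2 hz_snd (liftFst κ μ b)) = G • b := by
    rw [← hG_eq]
    exact adjoint_liftFst_mulL2 hz b
  refine ⟨G⁻¹ • mulL2 hz_snd (liftFst κ μ b), smul_sub_add_conj_apply hG hb hy hJ, ?_⟩
  rw [← ContinuousLinearMap.adjoint_inner_right, map_smul, hJ, inv_smul_smul₀ hG]
  exact inner_const_one_mulL2_const_one hGinv

end MonotoneSum

namespace CompactProb

lemma memLp_top_coe (μ : CompactProb) : MemLp (fun t : ℝ ↦ (t : ℂ)) ⊤ (μ.1 : Measure ℝ) := by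
  obtain ⟨M, -, hM⟩ := μ.exists_ae_abs_le
  exact memLp_top_of_bound (by fun_prop) M (by simpa using hM)

lemma eventually_memLp_top_inv_sub (μ : CompactProb) :
    ∀ᶠ z : ℂ in cobounded ℂ, MemLp (fun t : ℝ ↦ (z - (t : ℂ))⁻¹) ⊤ (μ.1 : Measure ℝ) ∧
      ∀ᵐ t : ℝ ∂(μ.1 : Measure ℝ), z - (t : ℂ) ≠ 0 := by
  obtain ⟨M, -, hM⟩ := μ.exists_ae_abs_le
  filter_upwards [tendsto_norm_cobounded_atTop.eventually_ge_atTop (M + 1)] with z hz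
  have hdist : ∀ᵐ t : ℝ ∂(μ.1 : Measure ℝ), 1 ≤ ‖z - t‖ := by
    filter_upwards [hM] with t ht
    have := norm_sub_norm_le z t
    rw [Complex.norm_real, Real.norm_eq_abs] at this
    linarith
  refine ⟨memLp_top_of_bound (by fun_prop) 1 ?_, ?_⟩
  · filter_upwards [hdist] with t ht
    rw [norm_inv]
    exact inv_le_one_of_one_le₀ ht
  · filter_upwards [hdist] with t ht
    exact norm_pos_iff.1 (zero_lt_one.trans_le ht)

lemma exists_monotoneConvolution (κ μ : CompactProb) :
    ∃ ν : CompactProb, ∀ᶠ z in cobounded ℂ, stieltjes ν z = stieltjes κ (stieltjes μ z)⁻¹ := by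
  let T := monotoneSum κ.memLp_top_coe μ.memLp_top_coe
  have hT : IsSelfAdjoint T := isSelfAdjoint_monotoneSum _ _
    (fun _ ↦ Complex.conj_ofReal _) (fun _ ↦ Complex.conj_ofReal _)
  have hnorm : ‖liftFst (κ.1 : Measure ℝ) (μ.1 : Measure ℝ) (Lp.const 2 _ 1)‖ = 1 := by
    simp [norm_liftFst, Lp.norm_const]
  obtain ⟨ν, hν⟩ := exists_stieltjes_eq_inner hT hnorm
  have hspec : ∀ᶠ z in cobounded ℂ, z ∉ spectrum ℂ T :=
    (spectrum.isCompact (𝕜 := ℂ) T).isBounded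
  have hinv : Tendsto (fun z ↦ (stieltjes μ z)⁻¹) (cobounded ℂ) (cobounded ℂ) :=
    tendsto_inv₀_nhdsNE_zero.comp μ.tendsto_stieltjes
  refine ⟨ν, ?_⟩
  filter_upwards [hspec, μ.eventually_memLp_top_inv_sub, μ.eventually_stieltjes_ne_zero,
    hinv.eventually κ.eventually_memLp_top_inv_sub] with z hz ⟨hr, hr'⟩ hG ⟨hs, hs'⟩
  obtain ⟨w, hw, hw_inner⟩ := exists_smul_sub_monotoneSum_eq κ.memLp_top_coe μ.memLp_top_coe
    hG rfl hr hr' hs hs'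
  exact (hν z hz w hw).trans hw_inner

end CompactProb

/-! ### The maps `𝔓` and `𝔔` -/

section Existence

variable {q : ℝ}

lemma exists_pRelation (hq : q ≠ 0) (hq₁ : 0 < 1 - q) (hq₂ : 0 < 1 + q) (μ : CompactProb) :
    ∃ ν, PRelation q μ ν := by
  obtain ⟨ν, hν⟩ := (betaProb hq₁ hq₂).exists_monotoneConvolution μ
  refine ⟨ν, (pRelation_iff_qLog hq).2 ?_⟩
  have hslit : ∀ᶠ g in 𝓝 (0 : ℂ), 1 - g ∈ Complex.slitPlane :=
    (Continuous.tendsto' (by fun_prop) (0 : ℂ) 1 (by simp)).eventually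
      (Complex.isOpen_slitPlane.mem_nhds Complex.one_mem_slitPlane)
  filter_upwards [hν, μ.tendsto_stieltjes.eventually (eventually_stieltjes_betaProb_inv hq hq₁ hq₂),
    μ.tendsto_stieltjes_nhds.eventually hslit] with z hz hbeta hmem
  rw [hz, hbeta, qLog_inv _ (Complex.mem_slitPlane_iff_arg.1 hmem).1]

lemma exists_qRelation (hq : q ≠ 0) (hq₁ : 0 < 1 - q) (hq₂ : 0 < 1 + q) (μ : CompactProb) :
    ∃ ν, QRelation q μ ν := by
  have hq₁' : 0 < 1 - -q := by rwa [sub_neg_eq_add]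
  have hq₂' : 0 < 1 + -q := by rwa [← sub_eq_add_neg]
  obtain ⟨ν, hν⟩ := ((betaProb hq₁' hq₂').map continuous_neg).exists_monotoneConvolution
    (μ.map (continuous_add_const 1))
  refine ⟨ν, (qRelation_iff_qLog hq).2 ?_⟩
  have hG : Tendsto (fun z ↦ -stieltjes μ (z - 1)) (cobounded ℂ) (𝓝[≠] 0) := by
    have hshift := tendsto_sub_const_cobounded (1 : ℂ)
    refine tendsto_nhdsWithin_iff.2 ⟨by simpa using (μ.tendsto_stieltjes_nhds.comp hshift).neg, ?_⟩
    exact (hshift.eventually μ.eventually_stieltjes_ne_zero).mono fun _ ↦ neg_ne_zero.2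
  filter_upwards [hν, hG.eventually
    (eventually_stieltjes_betaProb_inv (neg_ne_zero.2 hq) hq₁' hq₂')] with z hz hbeta
  rw [hz, CompactProb.stieltjes_map_neg, CompactProb.stieltjes_map_add_const, Complex.ofReal_one,
    ← inv_neg, hbeta, neg_neg, neg_neg, sub_neg_eq_add]

end Existence

theorem mainTheorem7 (q : ℝ) (hq_gt : -1 < q) (hq_lt : q < 1) (hq_ne : q ≠ 0) :
    (∀ μ : CompactProb, ∃! ν : CompactProb, PRelation q μ ν) ∧
    (∀ μ : CompactProb, ∃! lam : CompactProb, QRelation q μ lam) ∧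
    ∀ P Q : CompactProb → CompactProb,
      (∀ μ, PRelation q μ (P μ)) → (∀ μ, QRelation q μ (Q μ)) →
      Function.Injective P ∧ Function.Injective Q ∧
      ∀ ν₁ ν₂ ν : CompactProb, IsFreeConvolution ν₁ ν₂ ν →
        (∀ ρ : CompactProb, IsQuantizedConvolution q (P ν₁) (P ν₂) ρ ↔ ρ = P ν) ∧
        (∀ ρ : CompactProb, IsQuantizedConvolution q (Q ν₁) (Q ν₂) ρ ↔ ρ = Q ν) := by
  have hq₁ : 0 < 1 - q := by linarith
  have hq₂ : 0 < 1 + q := by linarith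
  refine ⟨fun μ ↦ ?_, fun μ ↦ ?_, fun P Q hP hQ ↦ ⟨fun μ μ' h ↦ ?_, fun μ μ' h ↦ ?_,
    fun ν₁ ν₂ ν hν ↦ ⟨?_, ?_⟩⟩⟩
  · obtain ⟨ν, hν⟩ := exists_pRelation hq_ne hq₁ hq₂ μ
    exact ⟨ν, hν, fun ν' hν' ↦ hν'.right_unique hq_ne hν⟩
  · obtain ⟨ν, hν⟩ := exists_qRelation hq_ne hq₁ hq₂ μ
    exact ⟨ν, hν, fun ν' hν' ↦ hν'.right_unique hq_ne hν⟩
  · exact (hP μ).left_unique (h ▸ hP μ')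
  · exact (hQ μ).left_unique (h ▸ hQ μ')
  · exact hν.isQuantizedConvolution_iff (hP ν₁).isQuantization (hP ν₂).isQuantization
      (hP ν).isQuantization
  · exact hν.isQuantizedConvolution_iff (hQ ν₁).isQuantization (hQ ν₂).isQuantization
      (hQ ν).isQuantization
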